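/- Let $Sol$ be the group $\mathbb R\ltimes\mathbb R^2$, with coordinates $(z,x,y)$ and product $(z,x,y)(z',x',y')=(z+z',\,x+e^{-z}x',\,y+e^{z}y')$. Let $\mu$ be a finitely supported probability measure on $Sol$ (so $\mu$ has finite entropy), and assume that its vertical drift $\alpha=\int_{Sol} z(g)\,d\mu(g)$ is nonzero. Let $X_1,X_2,\dots$ be independent random elements of $Sol$ of law $\mu$ and let $W_n=X_1\cdots X_n=(S_n,U_n,V_n)$, $W_0=\mathrm{id}$, be the associated random walk. If $\alpha>0$, then $U_n$ converges almost surely to a real random variable $\xi$; if $\alpha<0$, then $V_n$ converges almost surely to a real random variable $\xi'$. The harmonic measure $\nu$ is the probability measure on $\mathbb R$ which is the law of $\xi$ if $\alpha>0$, and the law of $\xi'$ if $\alpha<0$. Its Hausdorff dimension is $$\dim\nu=\inf\{\dim_H A \;:\; A\subset\mathbb R,\ \nu(\mathbb R\setminus A)=0\}.$$ With the Shannon entropy $H(m)=-\sum_g m(g)\log m(g)$, the limit defining the asymptotic entropy $$h_\mu=\lim_{k\to\infty}\frac{H(\mu^{*k})}{k}=\inf_{k\ge1}\frac{H(\mu^{*k})}{k}$$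 exists and the second equality holds. Moreover $$\dim\nu\le\frac{h_\mu}{|\alpha|}.$$ -/

import Mathlib

open MeasureTheory ProbabilityTheory Filter Topology
open scoped ENNReal

/-- The solvable Lie group `Sol = ℝ ⋉ ℝ²`, in coordinates `(z, x, y)`. -/
@[ext]
structure Sol where
  z : ℝ
  x : ℝ
  y : ℝ

namespace Sol

/-- The identity `(0, 0, 0)`. -/
instance : One Sol := ⟨⟨0, 0, 0⟩⟩

/-- The product `(z, x, y) (z', x', y') = (z + z', x + e^{-z} x', y + e^{z} y')`. -/
noncomputable instance : Mul Sol :=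
  ⟨fun g h => ⟨g.z + h.z, g.x + Real.exp (-g.z) * h.x, g.y + Real.exp g.z * h.y⟩⟩

/-- The inverse `(z, x, y)⁻¹ = (-z, -e^{z} x, -e^{-z} y)`. -/
noncomputable instance : Inv Sol :=
  ⟨fun g => ⟨-g.z, -(Real.exp g.z * g.x), -(Real.exp (-g.z) * g.y)⟩⟩

@[simp] theorem one_z : (1 : Sol).z = 0 := rfl
@[simp] theorem one_x : (1 : Sol).x = 0 := rfl
@[simp] theorem one_y : (1 : Sol).y = 0 := rfl
@[simp] theorem mul_z (g h : Sol) : (g * h).z = g.z + h.z := rfl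
@[simp] theorem mul_x (g h : Sol) : (g * h).x = g.x + Real.exp (-g.z) * h.x := rfl
@[simp] theorem mul_y (g h : Sol) : (g * h).y = g.y + Real.exp g.z * h.y := rfl
@[simp] theorem inv_z (g : Sol) : (g⁻¹).z = -g.z := rfl
@[simp] theorem inv_x (g : Sol) : (g⁻¹).x = -(Real.exp g.z * g.x) := rfl
@[simp] theorem inv_y (g : Sol) : (g⁻¹).y = -(Real.exp (-g.z) * g.y) := rfl

noncomputable instance : Group Sol :=
  Group.ofLeftAxioms
    (fun a b c => by
      ext
      · simp [add_assoc]
      · simp only [mul_x, mul_z, neg_add, Real.exp_add]; ring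
      · simp only [mul_y, mul_z, Real.exp_add]; ring)
    (fun a => by ext <;> simp)
    (fun a => by ext <;> simp)

/-- The Borel σ-algebra of `Sol`, transported from `ℝ³` by the coordinates. -/
instance : MeasurableSpace Sol :=
  MeasurableSpace.comap (fun g : Sol => (g.z, g.x, g.y)) inferInstance

theorem measurable_coords : Measurable (fun g : Sol => (g.z, g.x, g.y)) :=
  comap_measurable _

theorem measurable_z : Measurable Sol.z := measurable_coords.fst
theorem measurable_x : Measurable Sol.x := measurable_coords.snd.fst
theorem measurable_y : Measurable Sol.y := measurable_coords.snd.snd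

instance : MeasurableSingletonClass Sol where
  measurableSet_singleton g := by
    have h : ({g} : Set Sol) = (fun g : Sol => (g.z, g.x, g.y)) ⁻¹' {(g.z, g.x, g.y)} := by
      ext k
      simp [Sol.ext_iff]
    rw [h]
    exact measurable_coords (measurableSet_singleton _)

instance : MeasurableMul₂ Sol where
  measurable_mul := by
    rw [measurable_comap_iff]
    have h1 : Measurable (fun p : Sol × Sol => p.1) := measurable_fst
    have h2 : Measurable (fun p : Sol × Sol => p.2) := measurable_snd
    have h1z := measurable_z.comp h1
    exact (h1z.add (measurable_z.comp h2)).prodMk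
      (((measurable_x.comp h1).add
          ((Real.measurable_exp.comp h1z.neg).mul (measurable_x.comp h2))).prodMk
        ((measurable_y.comp h1).add
          ((Real.measurable_exp.comp h1z).mul (measurable_y.comp h2))))

/-- The vertical drift `α`: the mean of the projection of `μ` to the `z`-axis. -/
noncomputable def drift (μ : Measure Sol) : ℝ := ∫ g, g.z ∂μ

/-- The law of an i.i.d. sequence of increments of law `μ` (`ω j` is the increment `X_{j+1}`). -/
noncomputable def incrementLaw (μ : Measure Sol) [IsProbabilityMeasure μ] : Measure (ℕ → Sol) :=
  Measure.infinitePi fun _ => μ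

/-- The random walk `W_n = X_1 X_2 ⋯ X_n`, started at `W_0 = id`. -/
noncomputable def walk (ω : ℕ → Sol) : ℕ → Sol
  | 0 => 1
  | n + 1 => walk ω n * ω n

/-- `ξ`, the limit of the `x`-coordinates of the walk (meaningful where the limit exists). -/
noncomputable def xi (ω : ℕ → Sol) : ℝ := limUnder atTop fun n => (walk ω n).x

/-- `ξ'`, the limit of the `y`-coordinates of the walk (meaningful where the limit exists). -/
noncomputable def xi' (ω : ℕ → Sol) : ℝ := limUnder atTop fun n => (walk ω n).y

/-- The harmonic measure of the walk with nonzero vertical drift `α`, as a measure on the real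
line: the law of `ξ` if `α > 0` (on the line of upward vertical rays), and the law of `ξ'` if
`α < 0` (on the line of downward vertical rays). -/
noncomputable def harmonicMeasure (μ : Measure Sol) [IsProbabilityMeasure μ] : Measure ℝ :=
  if 0 < drift μ then (incrementLaw μ).map xi else (incrementLaw μ).map xi'

/-- The convolution power `μ^{*k}`. -/
noncomputable def convPow (μ : Measure Sol) : ℕ → Measure Sol
  | 0 => Measure.dirac 1
  | k + 1 => (convPow μ k).mconv μ

/-- The Shannon entropy `-∑ μ(g) log μ(g)` of a measure of finite support (or more generally of
countable support and finite entropy). -/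
noncomputable def shannonEntropy (μ : Measure Sol) : ℝ :=
  ∑' g : Sol, Real.negMulLog (μ.real {g})

/-- The asymptotic entropy `h_μ = inf_{k ≥ 1} H(μ^{*k}) / k`. -/
noncomputable def asymptoticEntropy (μ : Measure Sol) : ℝ :=
  sInf ((fun k : ℕ => shannonEntropy (convPow μ k) / k) '' Set.Ici 1)

end Sol

/-- The Hausdorff dimension of a measure on the line: the infimum of the Hausdorff dimensions of
the sets whose complement is null. -/
noncomputable def measureDim (ν : Measure ℝ) : ℝ≥0∞ :=
  ⨅ (A : Set ℝ) (_ : ν Aᶜ = 0), dimH A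

/-!
The vertical coordinate of the walk satisfies the law of large numbers, so in the contracting
direction the increments of the horizontal coordinate decay like `exp (-|α| n)`: the limit exists
and is approximated by the position at time `n` up to `exp (-b n)`, for every `b < |α|`
(`Sol.IsAffineAction.ae_exists_tendsto`). Both signs of the drift are treated at once, through the
pairs `(z, x)` and `(-z, y)`.

For the dimension, fix `k` and cut the walk into independent blocks of length `k`, each of law
`μ^{*k}`. By the law of large numbers for the information function `-log μ^{*k}`, almost every
sequence of blocks has, for large `n`, an initial word of `n` blocks of probability at least
`exp (-n (H(μ^{*k}) + δ))`, and there are at most `exp (n (H(μ^{*k}) + δ))` such words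
(`card_filter_prod_le`). Each word determines the limit up to `exp (-n k (|α| - δ))`. Hence a set of
full measure is a countable union of sets which at all small scales have covers with that many
intervals, and `dimH_le_of_exp_covers` bounds its dimension by
`(H(μ^{*k}) + δ) / (k (|α| - δ))` (`Sol.IsAffineAction.measureDim_le_of_block`). Then `δ → 0` and
`k → ∞`. Passing to blocks is what makes the law of large numbers sufficient: no
Shannon–McMillan–Breiman theorem for the random walk is required.

The limit defining the asymptotic entropy comes from Fekete's lemma, the entropy of convolution
powers being subadditive (`Sol.shannonEntropy_mconv_le`).
-/

/-! ### Measures carried by a finite set -/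

theorem Real.negMulLog_add_le {a b : ℝ} (ha : 0 ≤ a) (hb : 0 ≤ b) :
    Real.negMulLog (a + b) ≤ Real.negMulLog a + Real.negMulLog b := by
  rcases ha.eq_or_lt with rfl | ha
  · simp
  rcases hb.eq_or_lt with rfl | hb
  · simp
  have h1 := Real.log_le_log ha (by linarith : a ≤ a + b)
  have h2 := Real.log_le_log hb (by linarith : b ≤ a + b)
  simp only [Real.negMulLog]
  nlinarith [mul_le_mul_of_nonneg_left h1 ha.le, mul_le_mul_of_nonneg_left h2 hb.le]

theorem Real.negMulLog_sum_le {ι : Type*} (s : Finset ι) {r : ι → ℝ} (hr : ∀ i, 0 ≤ r i) :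
    Real.negMulLog (∑ i ∈ s, r i) ≤ ∑ i ∈ s, Real.negMulLog (r i) := by
  classical
  induction s using Finset.induction_on with
  | empty => simp
  | insert i s hi ih =>
    rw [Finset.sum_insert hi, Finset.sum_insert hi]
    linarith [Real.negMulLog_add_le (hr i) (Finset.sum_nonneg fun j _ => hr j : 0 ≤ ∑ j ∈ s, r j)]

section FiniteSupport

variable {α : Type*} [MeasurableSpace α] {ρ : Measure α} {F : Finset α}

theorem ae_mem_finset_of_measure_compl_eq_zero (hF : ρ (F : Set α)ᶜ = 0) : ∀ᵐ a ∂ρ, a ∈ F := by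
  rw [ae_iff]
  exact hF

theorem measureReal_singleton_eq_zero_of_notMem (hF : ρ (F : Set α)ᶜ = 0) {a : α} (ha : a ∉ F) :
    ρ.real {a} = 0 := by
  have : ρ {a} = 0 := measure_mono_null (by simpa using ha) hF
  simp [measureReal_def, this]

variable [MeasurableSingletonClass α] [IsFiniteMeasure ρ]

open scoped Classical in
/-- The measure of any set, measurable or not, is the sum of the atoms it contains. -/
theorem measureReal_eq_sum_of_finset (hF : ρ (F : Set α)ᶜ = 0) (s : Set α) :
    ρ.real s = ∑ a ∈ F with a ∈ s, ρ.real {a} := by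
  rw [sum_measureReal_singleton]
  refine measureReal_congr ?_
  filter_upwards [ae_mem_finset_of_measure_compl_eq_zero hF] with a ha
  refine propext ?_
  change a ∈ s ↔ a ∈ ((F.filter (· ∈ s) : Finset α) : Set α)
  simp [ha]

theorem measure_compl_filter_pos_eq_zero (hF : ρ (F : Set α)ᶜ = 0) :
    ρ ((F.filter fun a => 0 < ρ.real {a} : Finset α) : Set α)ᶜ = 0 := by
  classical
  rw [← measureReal_eq_zero_iff, measureReal_eq_sum_of_finset hF]
  refine Finset.sum_eq_zero fun a ha => ?_
  simp only [Finset.mem_filter, Set.mem_compl_iff, Finset.mem_coe, not_and, not_lt] at ha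
  exact le_antisymm (ha.2 ha.1) measureReal_nonneg

theorem integrable_of_finset (hF : ρ (F : Set α)ᶜ = 0) (f : α → ℝ) : Integrable f ρ := by
  have h := IntegrableOn.finset (μ := ρ) (s := F) (f := f)
  rwa [IntegrableOn, Measure.restrict_eq_self_of_ae_mem
    (ae_mem_finset_of_measure_compl_eq_zero hF)] at h

theorem integral_eq_sum_of_finset (hF : ρ (F : Set α)ᶜ = 0) (f : α → ℝ) :
    ∫ a, f a ∂ρ = ∑ a ∈ F, ρ.real {a} * f a := by
  have h := setIntegral_finset (μ := ρ) F (f := f) IntegrableOn.finset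
  rwa [Measure.restrict_eq_self_of_ae_mem (ae_mem_finset_of_measure_compl_eq_zero hF)] at h

end FiniteSupport

/-! ### Words of large probability -/

/-- Words of length `n` weighted by a product of sub-probability weights: at most `exp t` of them
have weight at least `exp (-t)`, because the weights sum to at most `1`. -/
theorem card_filter_prod_le {α : Type*} (F : Finset α) {p : α → ℝ} (hp : ∀ a, 0 ≤ p a)
    (hF : ∑ a ∈ F, p a ≤ 1) (n : ℕ) (t : ℝ) :
    (((Fintype.piFinset fun _ : Fin n => F).filter
      fun w => Real.exp (-t) ≤ ∏ i, p (w i)).card : ℝ) ≤ Real.exp t := by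
  set T := (Fintype.piFinset fun _ : Fin n => F).filter
    fun w => Real.exp (-t) ≤ ∏ i, p (w i)
  have h1 : (T.card : ℝ) * Real.exp (-t) ≤ 1 := calc
    (T.card : ℝ) * Real.exp (-t) = ∑ _w ∈ T, Real.exp (-t) := by simp
    _ ≤ ∑ w ∈ T, ∏ i, p (w i) := Finset.sum_le_sum fun w hw => (Finset.mem_filter.1 hw).2
    _ ≤ ∑ w ∈ Fintype.piFinset fun _ : Fin n => F, ∏ i, p (w i) :=
      Finset.sum_le_sum_of_subset_of_nonneg (Finset.filter_subset _ _)
        fun w _ _ => Finset.prod_nonneg fun i _ => hp _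
    _ = ∏ _i : Fin n, ∑ a ∈ F, p a := (Finset.prod_univ_sum (fun _ => F) fun _ a => p a).symm
    _ ≤ 1 := Finset.prod_le_one (fun i _ => Finset.sum_nonneg fun a _ => hp a) fun i _ => hF
  rw [Real.exp_neg, ← div_eq_mul_inv, div_le_one (Real.exp_pos t)] at h1
  exact h1

/-! ### Hausdorff dimension from covers at exponentially small scales -/

/-- A set of reals which, for all large `n`, is covered by `exp (n a)` intervals of radius
`exp (-n b)` has Hausdorff dimension at most `a / b`. -/
theorem dimH_le_of_exp_covers {S : Set ℝ} {a b : ℝ} (ha : 0 ≤ a) (hb : 0 < b)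
    (T : ℕ → Finset ℝ) (hcard : ∀ᶠ n : ℕ in atTop, ((T n).card : ℝ) ≤ Real.exp (n * a))
    (hcov : ∀ᶠ n : ℕ in atTop, S ⊆ ⋃ c : T n, Metric.closedBall (c : ℝ) (Real.exp (-(n * b)))) :
    dimH S ≤ ENNReal.ofReal (a / b) := by
  refine le_of_forall_gt_imp_ge_of_dense fun d hd => ?_
  rcases eq_or_ne d ∞ with rfl | hdtop
  · exact le_top
  lift d to NNReal using hdtop
  have hd' : a < b * d := by
    have := (ENNReal.ofReal_lt_ofReal_iff_of_nonneg (div_nonneg ha hb.le)).1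
      (by rwa [ENNReal.ofReal_coe_nnreal] : ENNReal.ofReal (a / b) < ENNReal.ofReal (d : ℝ))
    rwa [div_lt_iff₀ hb, mul_comm] at this
  have hd0 : (0 : ℝ) ≤ d := d.coe_nonneg
  have hexp : ∀ c : ℝ, 0 < c → Tendsto (fun n : ℕ => Real.exp (-(n * c))) atTop (𝓝 0) :=
    fun c hc => Real.tendsto_exp_neg_atTop_nhds_zero.comp
      (tendsto_natCast_atTop_atTop.atTop_mul_const hc)
  refine dimH_le_of_hausdorffMeasure_ne_top (d := d) ?_
  have hle := Measure.hausdorffMeasure_le_liminf_sum (d : ℝ) S (l := atTop)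
    (fun n : ℕ => ENNReal.ofReal (2 * Real.exp (-(n * b))))
    (by simpa using ENNReal.tendsto_ofReal ((hexp b hb).const_mul 2))
    (fun n (c : T n) => Metric.closedBall (c : ℝ) (Real.exp (-(n * b))))
    (Eventually.of_forall fun n c => by
      rw [Real.closedBall_eq_Icc, Real.ediam_Icc]
      exact ENNReal.ofReal_le_ofReal (by linarith)) hcov
  have hlim : Tendsto (fun n : ℕ => ∑ c : T n,
      Metric.ediam (Metric.closedBall (c : ℝ) (Real.exp (-(n * b)))) ^ (d : ℝ)) atTop (𝓝 0) := by
    have hup : Tendsto (fun n : ℕ =>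
        ENNReal.ofReal ((2 : ℝ) ^ (d : ℝ) * Real.exp (-(n * (b * d - a))))) atTop (𝓝 0) := by
      simpa using ENNReal.tendsto_ofReal ((hexp _ (sub_pos.2 hd')).const_mul ((2 : ℝ) ^ (d : ℝ)))
    refine tendsto_of_tendsto_of_tendsto_of_le_of_le' tendsto_const_nhds hup
      (Eventually.of_forall fun n => zero_le) ?_
    filter_upwards [hcard] with n hn
    have hball : ∀ c : ℝ, Metric.ediam (Metric.closedBall c (Real.exp (-(n * b)))) ^ (d : ℝ)
        = ENNReal.ofReal ((2 : ℝ) ^ (d : ℝ) * Real.exp (-(n * (b * d)))) := by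
      intro c
      rw [Real.closedBall_eq_Icc, Real.ediam_Icc, ENNReal.ofReal_rpow_of_nonneg
        (by linarith [Real.exp_pos (-(n * b))]) hd0,
        show c + Real.exp (-(n * b)) - (c - Real.exp (-(n * b))) = 2 * Real.exp (-(n * b)) by ring,
        Real.mul_rpow (by norm_num) (Real.exp_pos _).le, ← Real.exp_mul]
      congr 3
      ring
    simp only [hball, Finset.sum_const, Finset.card_univ, Fintype.card_coe, nsmul_eq_mul]
    rw [← ENNReal.ofReal_natCast, ← ENNReal.ofReal_mul (Nat.cast_nonneg _)]
    refine ENNReal.ofReal_le_ofReal ?_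
    calc ((T n).card : ℝ) * ((2 : ℝ) ^ (d : ℝ) * Real.exp (-(n * (b * d))))
        ≤ Real.exp (n * a) * ((2 : ℝ) ^ (d : ℝ) * Real.exp (-(n * (b * d)))) := by gcongr
      _ = (2 : ℝ) ^ (d : ℝ) * (Real.exp (n * a) * Real.exp (-(n * (b * d)))) := by ring
      _ = _ := by rw [← Real.exp_add]; ring_nf
  rw [hlim.liminf_eq] at hle
  exact ne_top_of_le_ne_top ENNReal.zero_ne_top hle

/-- A real sequence whose increments are eventually `O(exp (-b n))` converges, at any exponential
rate below `b`. -/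
theorem exists_tendsto_of_exp_increments {f : ℕ → ℝ} {C b : ℝ} (hb : 0 < b)
    (hf : ∀ᶠ n : ℕ in atTop, |f (n + 1) - f n| ≤ C * Real.exp (-(b * n))) :
    ∃ l, Tendsto f atTop (𝓝 l) ∧
      ∀ b' < b, ∀ᶠ n : ℕ in atTop, |f n - l| ≤ Real.exp (-(b' * n)) := by
  obtain ⟨N, hN⟩ := eventually_atTop.1 hf
  set r := Real.exp (-b) with hr
  have hr1 : r < 1 := by rw [hr, Real.exp_lt_one_iff]; linarith
  have hpow : ∀ n : ℕ, Real.exp (-(b * n)) = r ^ n := fun n => by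
    rw [hr, ← Real.exp_nat_mul]; ring_nf
  have hg : ∀ n, dist (f (n + N)) (f (n + 1 + N)) ≤ (C * r ^ N) * r ^ n := fun n => by
    have := hN (n + N) (by omega)
    rw [hpow, pow_add] at this
    rw [dist_comm, Real.dist_eq, show n + 1 + N = n + N + 1 by omega]
    linarith
  obtain ⟨l, hl⟩ := cauchySeq_tendsto_of_complete
    (cauchySeq_of_le_geometric (f := fun n => f (n + N)) r (C * r ^ N) hr1 hg)
  refine ⟨l, (tendsto_add_atTop_iff_nat N).1 hl, fun b' hb' => ?_⟩
  have hdist := dist_le_of_le_geometric_of_tendsto r (C * r ^ N) hr1 hg hl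
  -- the constant of the geometric bound is absorbed by the gap between `b'` and `b`
  have hsmall : ∀ᶠ n : ℕ in atTop, C / (1 - r) * Real.exp (-(n * (b - b'))) ≤ 1 := by
    have : Tendsto (fun n : ℕ => C / (1 - r) * Real.exp (-(n * (b - b')))) atTop (𝓝 0) := by
      simpa using (Real.tendsto_exp_neg_atTop_nhds_zero.comp
        (tendsto_natCast_atTop_atTop.atTop_mul_const (sub_pos.2 hb'))).const_mul (C / (1 - r))
    exact this.eventually_le_const one_pos
  filter_upwards [hsmall, eventually_ge_atTop N] with n hn hNn
  obtain ⟨m, rfl⟩ := Nat.exists_eq_add_of_le' hNn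
  have h1 := hdist m
  rw [Real.dist_eq] at h1
  have h2 : C * r ^ N * r ^ m / (1 - r) = C / (1 - r) * Real.exp (-(b * (m + N : ℕ))) := by
    rw [hpow, pow_add]; ring
  have h3 : Real.exp (-(b * (m + N : ℕ)))
      = Real.exp (-((m + N : ℕ) * (b - b'))) * Real.exp (-(b' * (m + N : ℕ))) := by
    rw [← Real.exp_add]; ring_nf
  rw [h2, h3, ← mul_assoc] at h1
  exact h1.trans (mul_le_of_le_one_left (Real.exp_pos _).le hn)

namespace Sol

/-! ### Convolution powers and their entropy -/

section Convolution

variable {μ ν : Measure Sol}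

instance isProbabilityMeasure_convPow [IsProbabilityMeasure μ] (k : ℕ) :
    IsProbabilityMeasure (convPow μ k) := by
  induction k with
  | zero => exact Measure.dirac.isProbabilityMeasure
  | succ k ih => rw [convPow]; infer_instance

theorem convPow_one [IsProbabilityMeasure μ] : convPow μ 1 = μ := by
  rw [convPow, convPow, Measure.dirac_one_mconv]

theorem convPow_add [IsProbabilityMeasure μ] (m n : ℕ) :
    convPow μ (m + n) = (convPow μ m).mconv (convPow μ n) := by
  induction n with
  | zero => rw [Nat.add_zero, convPow, Measure.mconv_dirac_one]
  | succ n ih => rw [← Nat.add_assoc, convPow, ih, Measure.mconv_assoc, convPow]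

theorem ae_prod_mem_product [IsProbabilityMeasure μ] [IsProbabilityMeasure ν]
    {F G : Finset Sol} (hF : μ (F : Set Sol)ᶜ = 0) (hG : ν (G : Set Sol)ᶜ = 0) :
    ∀ᵐ q ∂(μ.prod ν), q ∈ F ×ˢ G := by
  filter_upwards [Measure.quasiMeasurePreserving_fst.ae (ae_mem_finset_of_measure_compl_eq_zero hF),
    Measure.quasiMeasurePreserving_snd.ae (ae_mem_finset_of_measure_compl_eq_zero hG)]
    with q hq1 hq2
  exact Finset.mem_product.2 ⟨hq1, hq2⟩

open scoped Classical in
theorem mconv_compl_image_eq_zero [IsProbabilityMeasure μ] [IsProbabilityMeasure ν]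
    {F G : Finset Sol} (hF : μ (F : Set Sol)ᶜ = 0) (hG : ν (G : Set Sol)ᶜ = 0) :
    μ.mconv ν (((F ×ˢ G).image fun q => q.1 * q.2 : Finset Sol) : Set Sol)ᶜ = 0 := by
  rw [Measure.mconv, Measure.map_apply measurable_mul (Finset.measurableSet _).compl]
  have h : ∀ᵐ q ∂(μ.prod ν), q.1 * q.2 ∈ (F ×ˢ G).image fun q => q.1 * q.2 := by
    filter_upwards [ae_prod_mem_product hF hG] with q hq
    exact Finset.mem_image_of_mem _ hq
  exact ae_iff.1 h

theorem exists_finset_convPow [IsProbabilityMeasure μ] {F : Finset Sol}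
    (hF : μ (F : Set Sol)ᶜ = 0) (k : ℕ) : ∃ G : Finset Sol, convPow μ k (G : Set Sol)ᶜ = 0 := by
  classical
  induction k with
  | zero => exact ⟨{1}, by simp [convPow]⟩
  | succ k ih =>
    obtain ⟨G, hG⟩ := ih
    exact ⟨_, mconv_compl_image_eq_zero hG hF⟩

theorem shannonEntropy_eq_sum [IsFiniteMeasure μ] {F : Finset Sol} (hF : μ (F : Set Sol)ᶜ = 0) :
    shannonEntropy μ = ∑ g ∈ F, Real.negMulLog (μ.real {g}) :=
  tsum_eq_sum fun g hg => by rw [measureReal_singleton_eq_zero_of_notMem hF hg, Real.negMulLog_zero]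

theorem shannonEntropy_nonneg [IsProbabilityMeasure μ] : 0 ≤ shannonEntropy μ :=
  tsum_nonneg fun _ => Real.negMulLog_nonneg measureReal_nonneg measureReal_le_one

/-- The entropy of a convolution is at most that of the product measure: pushing forward along
the multiplication merges atoms, and `negMulLog` is subadditive. -/
theorem shannonEntropy_mconv_le [IsProbabilityMeasure μ] [IsProbabilityMeasure ν]
    {F G : Finset Sol} (hF : μ (F : Set Sol)ᶜ = 0) (hG : ν (G : Set Sol)ᶜ = 0) :
    shannonEntropy (μ.mconv ν) ≤ shannonEntropy μ + shannonEntropy ν := by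
  classical
  set r : Sol × Sol → ℝ := fun q => μ.real {q.1} * ν.real {q.2} with hr
  have hr0 : ∀ q, 0 ≤ r q := fun q => mul_nonneg measureReal_nonneg measureReal_nonneg
  have hprod : (μ.prod ν) ((F ×ˢ G : Finset (Sol × Sol)) : Set (Sol × Sol))ᶜ = 0 :=
    ae_iff.1 (ae_prod_mem_product hF hG)
  have hatom : ∀ g, (μ.mconv ν).real {g} = ∑ q ∈ F ×ˢ G with q.1 * q.2 = g, r q := fun g => by
    rw [Measure.mconv, map_measureReal_apply measurable_mul (measurableSet_singleton g),
      measureReal_eq_sum_of_finset hprod]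
    refine Finset.sum_congr (by ext; simp) fun q _ => ?_
    change (μ.prod ν).real {q} = μ.real {q.1} * ν.real {q.2}
    rw [← measureReal_prod_prod, Set.singleton_prod_singleton]
  have hF1 : ∑ a ∈ F, μ.real {a} = 1 := by
    have := integral_eq_sum_of_finset hF fun _ => (1 : ℝ)
    simpa using this.symm
  have hG1 : ∑ a ∈ G, ν.real {a} = 1 := by
    have := integral_eq_sum_of_finset hG fun _ => (1 : ℝ)
    simpa using this.symm
  rw [shannonEntropy_eq_sum (mconv_compl_image_eq_zero hF hG), shannonEntropy_eq_sum hF,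
    shannonEntropy_eq_sum hG]
  calc ∑ g ∈ (F ×ˢ G).image (fun q => q.1 * q.2), Real.negMulLog ((μ.mconv ν).real {g})
      ≤ ∑ g ∈ (F ×ˢ G).image (fun q => q.1 * q.2),
          ∑ q ∈ F ×ˢ G with q.1 * q.2 = g, Real.negMulLog (r q) :=
        Finset.sum_le_sum fun g _ => by
          rw [hatom]
          exact Real.negMulLog_sum_le _ hr0
    _ = ∑ q ∈ F ×ˢ G, Real.negMulLog (r q) :=
        Finset.sum_fiberwise_of_maps_to (fun q hq => Finset.mem_image_of_mem _ hq) _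
    _ = ∑ a ∈ F, Real.negMulLog (μ.real {a}) + ∑ b ∈ G, Real.negMulLog (ν.real {b}) := by
        simp only [hr, Real.negMulLog_mul, Finset.sum_product, Finset.sum_add_distrib,
          ← Finset.sum_mul, ← Finset.mul_sum, hF1, hG1, one_mul]

/-- Fekete's lemma for the entropies of the convolution powers; its limit is the infimum that
defines the asymptotic entropy. -/
theorem tendsto_shannonEntropy_convPow_div [IsProbabilityMeasure μ] {F : Finset Sol}
    (hF : μ (F : Set Sol)ᶜ = 0) :
    Tendsto (fun k : ℕ => shannonEntropy (convPow μ k) / k) atTop (𝓝 (asymptoticEntropy μ)) := by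
  have hsub : Subadditive fun k => shannonEntropy (convPow μ k) := fun m n => by
    obtain ⟨G, hG⟩ := exists_finset_convPow hF m
    obtain ⟨G', hG'⟩ := exists_finset_convPow hF n
    simp only [convPow_add]
    exact shannonEntropy_mconv_le hG hG'
  rw [asymptoticEntropy, ← Subadditive.lim.eq_1 hsub]
  refine hsub.tendsto_lim ⟨0, ?_⟩
  rintro _ ⟨n, rfl⟩
  exact div_nonneg shannonEntropy_nonneg (Nat.cast_nonneg _)

/-- The entropy is the mean of the information function `-log μ(g)`. -/
theorem integral_neg_log_eq_shannonEntropy [IsProbabilityMeasure μ] {F : Finset Sol}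
    (hF : μ (F : Set Sol)ᶜ = 0) :
    ∫ g, -Real.log (μ.real {g}) ∂μ = shannonEntropy μ := by
  rw [integral_eq_sum_of_finset hF, shannonEntropy_eq_sum hF]
  exact Finset.sum_congr rfl fun g _ => by rw [Real.negMulLog]; ring

theorem measurable_neg_log_measureReal {F : Finset Sol}
    (hF : μ (F : Set Sol)ᶜ = 0) : Measurable fun g => -Real.log (μ.real {g}) := by
  refine (measurable_const (a := (0 : ℝ))).measurable_of_countable_ne
    (F.countable_toSet.mono fun g hg => ?_)
  by_contra hgF
  exact hg (by simp [measureReal_singleton_eq_zero_of_notMem hF hgF])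

end Convolution

/-! ### The walk cut into blocks -/

theorem walk_congr {ω ω' : ℕ → Sol} {n : ℕ} (h : ∀ i < n, ω i = ω' i) :
    walk ω n = walk ω' n := by
  induction n with
  | zero => rfl
  | succ n ih => rw [walk, walk, ih fun i hi => h i (by omega), h n (by omega)]

theorem walk_add (ω : ℕ → Sol) (m n : ℕ) :
    walk ω (m + n) = walk ω m * walk (fun i => ω (m + i)) n := by
  induction n with
  | zero => simp [walk]
  | succ n ih => rw [← Nat.add_assoc, walk, ih, walk, mul_assoc]

theorem measurable_walk (n : ℕ) : Measurable fun ω : ℕ → Sol => walk ω n := by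
  induction n with
  | zero => exact measurable_const
  | succ n ih => exact ih.mul (measurable_pi_apply n)

/-- The product of the `j`-th block of `k` consecutive increments. -/
noncomputable def block (k j : ℕ) (ω : ℕ → Sol) : Sol := walk (fun i => ω (j * k + i)) k

theorem measurable_block (k j : ℕ) : Measurable (block k j) :=
  (measurable_walk k).comp (measurable_pi_lambda _ fun i => measurable_pi_apply (j * k + i))

/-- The walk whose increments are the blocks is the original walk observed at multiples of `k`. -/
theorem walk_block (k n : ℕ) (ω : ℕ → Sol) :
    walk (fun j => block k j ω) n = walk ω (n * k) := by
  induction n with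
  | zero => simp [walk]
  | succ n ih => rw [walk, ih, Nat.succ_mul, walk_add, block]

section Law

variable (μ : Measure Sol) [IsProbabilityMeasure μ]

instance isProbabilityMeasure_incrementLaw : IsProbabilityMeasure (incrementLaw μ) := by
  unfold incrementLaw; infer_instance

theorem iIndepFun_increments : iIndepFun (fun (i : ℕ) (ω : ℕ → Sol) => ω i) (incrementLaw μ) :=
  iIndepFun_infinitePi (P := fun _ : ℕ => μ) (X := fun _ g => g) fun _ => measurable_id

/-- Products of increments over two disjoint stretches of time are independent. -/
theorem indepFun_walk_shift {a b k l : ℕ} (h : a + k ≤ b) :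
    IndepFun (fun ω : ℕ → Sol => walk (fun i => ω (a + i)) k)
      (fun ω => walk (fun i => ω (b + i)) l) (incrementLaw μ) := by
  have hdisj : Disjoint (Finset.Ico a (a + k)) (Finset.Ico b (b + l)) := by
    rw [Finset.disjoint_left]
    intro i hi hi'
    simp only [Finset.mem_Ico] at hi hi'
    omega
  have hind := (iIndepFun_increments μ).indepFun_finset _ _ hdisj fun i => measurable_pi_apply i
  -- the product over a stretch as a function of the increments of that stretch only
  let φ : (c m : ℕ) → (Finset.Ico c (c + m) → Sol) → Sol := fun c m u =>
    walk (fun i => if hi : c + i ∈ Finset.Ico c (c + m) then u ⟨c + i, hi⟩ else 1) m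
  have hφ : ∀ c m, Measurable (φ c m) := fun c m => by
    refine (measurable_walk m).comp (measurable_pi_lambda _ fun i => ?_)
    by_cases hi : c + i ∈ Finset.Ico c (c + m)
    · simp only [hi, dite_true]; exact measurable_pi_apply _
    · simp only [hi, dite_false]; exact measurable_const
  have heq : ∀ c m, (fun ω : ℕ → Sol => walk (fun i => ω (c + i)) m)
      = φ c m ∘ fun ω (i : Finset.Ico c (c + m)) => ω i := fun c m => by
    funext ω
    refine walk_congr fun i hi => ?_
    have : c + i ∈ Finset.Ico c (c + m) := by simp; omega
    simp only [this, dite_true]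
  rw [heq a k, heq b l]
  exact hind.comp (hφ a k) (hφ b l)

theorem map_walk_shift (a k : ℕ) :
    (incrementLaw μ).map (fun ω => walk (fun i => ω (a + i)) k) = convPow μ k := by
  have hmeas : ∀ a k, Measurable fun ω : ℕ → Sol => walk (fun i => ω (a + i)) k := fun a k =>
    (measurable_walk k).comp (measurable_pi_lambda _ fun i => measurable_pi_apply (a + i))
  induction k with
  | zero => simp [walk, convPow]
  | succ k ih =>
    have hind := indepFun_walk_shift μ (a := a) (k := k) (b := a + k) (l := 1) le_rfl
    have heval : (fun ω : ℕ → Sol => walk (fun i => ω (a + k + i)) 1) = fun ω => ω (a + k) := by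
      funext ω; simp [walk]
    rw [heval] at hind
    have := hind.map_mul_eq_map_mconv_map (hmeas a k) (measurable_pi_apply _)
    rw [convPow, ← ih]
    rw [show (incrementLaw μ).map (fun ω => ω (a + k)) = μ from
      Measure.infinitePi_map_eval (fun _ : ℕ => μ) (a + k)] at this
    exact this

theorem map_block (k j : ℕ) : (incrementLaw μ).map (block k j) = convPow μ k :=
  map_walk_shift μ (j * k) k

theorem block_one (j : ℕ) (ω : ℕ → Sol) : block 1 j ω = ω j := by
  simp [block, walk]

theorem ae_block_mem {k : ℕ} {F : Finset Sol} (hF : convPow μ k (F : Set Sol)ᶜ = 0) :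
    ∀ᵐ ω ∂(incrementLaw μ), ∀ j, block k j ω ∈ F := by
  refine ae_all_iff.2 fun j => ?_
  refine ae_of_ae_map (measurable_block k j).aemeasurable ?_
  rw [map_block]
  exact ae_mem_finset_of_measure_compl_eq_zero hF

/-- The strong law of large numbers along the blocks. -/
theorem strong_law_block (k : ℕ) {f : Sol → ℝ} (hf : Measurable f)
    (hint : Integrable f (convPow μ k)) :
    ∀ᵐ ω ∂(incrementLaw μ), Tendsto (fun n : ℕ => (∑ j ∈ Finset.range n, f (block k j ω)) / n)
      atTop (𝓝 (∫ g, f g ∂(convPow μ k))) := by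
  have hind : ∀ i j, i < j → IndepFun (block k i) (block k j) (incrementLaw μ) := fun i j hij =>
    indepFun_walk_shift μ (by nlinarith [Nat.mul_le_mul_right k hij, Nat.succ_mul i k])
  have h := strong_law_ae_real (μ := incrementLaw μ) (fun j ω => f (block k j ω))
    (by
      rw [← map_block μ k 0] at hint
      exact hint.comp_measurable (measurable_block k 0))
    (fun i j hij => by
      rcases lt_or_gt_of_ne hij with h | h
      · exact (hind i j h).comp hf hf
      · exact ((hind j i h).comp hf hf).symm)
    (fun j => IdentDistrib.comp (u := f)
      ⟨(measurable_block k j).aemeasurable, (measurable_block k 0).aemeasurable,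
        by rw [map_block, map_block]⟩ hf)
  rwa [← map_block μ k 0, integral_map (measurable_block k 0).aemeasurable
    hf.aestronglyMeasurable]

end Law

/-! ### Convergence in a contracting direction -/

/-- `g ↦ (t ↦ p g + exp (-s g) t)` is a measurable action of `Sol` on the line by affine maps.
The pairs `(z, x)` and `(-z, y)` are of this kind, and treating them together covers both signs
of the drift. -/
structure IsAffineAction (s p : Sol → ℝ) : Prop where
  map_mul (g h : Sol) : s (g * h) = s g + s h
  apply_mul (g h : Sol) : p (g * h) = p g + Real.exp (-s g) * p h
  measurable_height : Measurable s
  measurable_apply : Measurable p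

theorem isAffineAction_z_x : IsAffineAction z x where
  map_mul _ _ := rfl
  apply_mul _ _ := rfl
  measurable_height := measurable_z
  measurable_apply := measurable_x

theorem isAffineAction_neg_z_y : IsAffineAction (fun g => -g.z) y where
  map_mul g h := by rw [mul_z, neg_add]
  apply_mul g h := by rw [mul_y, neg_neg]
  measurable_height := measurable_z.neg
  measurable_apply := measurable_y

namespace IsAffineAction

variable {s p : Sol → ℝ}

theorem height_walk (hsp : IsAffineAction s p) (ω : ℕ → Sol) (n : ℕ) :
    s (walk ω n) = ∑ j ∈ Finset.range n, s (ω j) := by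
  induction n with
  | zero =>
    have := hsp.map_mul 1 1
    rw [mul_one] at this
    simpa [walk] using this
  | succ n ih => rw [walk, hsp.map_mul, ih, Finset.sum_range_succ]

variable {μ : Measure Sol} [IsProbabilityMeasure μ] {F : Finset Sol}

/-- If the mean of `s` is positive, the orbit of `0` under the walk converges almost surely, at
any exponential rate smaller than this mean: the `n`-th increment of the orbit is bounded by a
constant times `exp (-s (W_n))`. -/
theorem ae_exists_tendsto (hsp : IsAffineAction s p) (hF : μ (F : Set Sol)ᶜ = 0)
    (hpos : 0 < ∫ g, s g ∂μ) :
    ∀ᵐ ω ∂(incrementLaw μ), ∃ l, Tendsto (fun n => p (walk ω n)) atTop (𝓝 l) ∧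
      ∀ b < ∫ g, s g ∂μ, ∀ᶠ n : ℕ in atTop, |p (walk ω n) - l| ≤ Real.exp (-(b * n)) := by
  have hF1 : convPow μ 1 (F : Set Sol)ᶜ = 0 := by rwa [convPow_one]
  have hlaw := strong_law_block μ 1 hsp.measurable_height (integrable_of_finset hF1 s)
  filter_upwards [hlaw, ae_block_mem μ hF1] with ω hω hmem
  simp only [block_one] at hω hmem
  rw [convPow_one] at hω
  set α := ∫ g, s g ∂μ
  have key : ∀ b, 0 < b → b < α → ∃ l, Tendsto (fun n => p (walk ω n)) atTop (𝓝 l) ∧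
      ∀ b' < b, ∀ᶠ n : ℕ in atTop, |p (walk ω n) - l| ≤ Real.exp (-(b' * n)) := by
    intro b hb0 hb
    refine exists_tendsto_of_exp_increments (C := ∑ g ∈ F, |p g|) hb0 ?_
    filter_upwards [hω.eventually_const_le hb, eventually_gt_atTop 0] with n hn hn0
    have hn0' : (0 : ℝ) < n := Nat.cast_pos.2 hn0
    rw [le_div_iff₀ hn0', ← hsp.height_walk] at hn
    rw [walk, hsp.apply_mul, add_sub_cancel_left, abs_mul, Real.abs_exp, mul_comm]
    exact mul_le_mul (Finset.single_le_sum (f := fun g => |p g|) (fun g _ => abs_nonneg _) (hmem n))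
      (Real.exp_le_exp.2 (by linarith)) (Real.exp_pos _).le
      (Finset.sum_nonneg fun g _ => abs_nonneg _)
  obtain ⟨l, hl, -⟩ := key (α / 2) (by linarith) (by linarith)
  refine ⟨l, hl, fun b hb => ?_⟩
  obtain ⟨c, hc, hcα⟩ := exists_between (max_lt hb hpos)
  obtain ⟨l', hl', hrate⟩ := key c ((le_max_right _ _).trans_lt hc) hcα
  rw [tendsto_nhds_unique hl hl']
  exact hrate b ((le_max_left _ _).trans_lt hc)

theorem ae_tendsto_limUnder (hsp : IsAffineAction s p) (hF : μ (F : Set Sol)ᶜ = 0)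
    (hpos : 0 < ∫ g, s g ∂μ) :
    ∀ᵐ ω ∂(incrementLaw μ), Tendsto (fun n => p (walk ω n)) atTop
      (𝓝 (limUnder atTop fun n => p (walk ω n))) := by
  filter_upwards [hsp.ae_exists_tendsto hF hpos] with ω ⟨l, hl, _⟩
  exact tendsto_nhds_limUnder ⟨l, hl⟩

theorem aemeasurable_limUnder (hsp : IsAffineAction s p) (hF : μ (F : Set Sol)ᶜ = 0)
    (hpos : 0 < ∫ g, s g ∂μ) :
    AEMeasurable (fun ω => limUnder atTop fun n => p (walk ω n)) (incrementLaw μ) :=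
  aemeasurable_of_tendsto_metrizable_ae atTop
    (fun n => (hsp.measurable_apply.comp (measurable_walk n)).aemeasurable)
    (hsp.ae_tendsto_limUnder hF hpos)

/-! ### The dimension of the harmonic measure -/

/-- For blocks of length `k`, the law of large numbers for the information function bounds the
number of typical words of `n` blocks by `exp (n a)`; each determines the limit up to an error
`exp (-(n k b))`. -/
theorem measureDim_le_of_block (hsp : IsAffineAction s p) (hF : μ (F : Set Sol)ᶜ = 0)
    {k : ℕ} (hk : k ≠ 0) {a b : ℝ} (ha : shannonEntropy (convPow μ k) < a) (hb0 : 0 < b)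
    (hb : b < ∫ g, s g ∂μ) :
    measureDim ((incrementLaw μ).map fun ω => limUnder atTop fun n => p (walk ω n))
      ≤ ENNReal.ofReal (a / (k * b)) := by
  classical
  have hpos : 0 < ∫ g, s g ∂μ := hb0.trans hb
  have hk0 : (0 : ℝ) < k := Nat.cast_pos.2 (Nat.pos_of_ne_zero hk)
  obtain ⟨G₀, hG₀⟩ := exists_finset_convPow hF k
  -- only atoms of positive mass are kept, so that `exp (-(-log q)) = q` on `G`
  set q : Sol → ℝ := fun g => (convPow μ k).real {g}
  set G := G₀.filter fun g => 0 < q g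
  have hG : convPow μ k (G : Set Sol)ᶜ = 0 := measure_compl_filter_pos_eq_zero hG₀
  have hsum : ∑ g ∈ G, q g ≤ 1 := by
    rw [sum_measureReal_singleton]
    exact measureReal_le_one
  let W : (n : ℕ) → Finset (Fin n → Sol) := fun n =>
    (Fintype.piFinset fun _ : Fin n => G).filter fun w => Real.exp (-(n * a)) ≤ ∏ i, q (w i)
  let c : (n : ℕ) → (Fin n → Sol) → ℝ := fun n w =>
    p (walk (fun i => if hi : i < n then w ⟨i, hi⟩ else 1) n)
  let T : ℕ → Finset ℝ := fun n => (W n).image (c n)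
  let B : ℕ → Set ℝ := fun n =>
    ⋃ t : T n, Metric.closedBall (t : ℝ) (Real.exp (-(n * (k * b))))
  have hmeas : MeasurableSet (⋃ N, ⋂ n ≥ N, B n) :=
    MeasurableSet.iUnion fun N => MeasurableSet.iInter fun n => MeasurableSet.iInter fun _ =>
      MeasurableSet.iUnion fun t => measurableSet_closedBall
  -- this set is Borel, so its complement can be tested by pulling back along the limit map
  refine (iInf₂_le (⋃ N, ⋂ n ≥ N, B n) ?_).trans ?_
  · rw [Measure.map_apply_of_aemeasurable (hsp.aemeasurable_limUnder hF hpos) hmeas.compl]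
    suffices h : ∀ᵐ ω ∂(incrementLaw μ),
        (limUnder atTop fun n => p (walk ω n)) ∈ ⋃ N, ⋂ n ≥ N, B n from ae_iff.1 h
    have hlaw := strong_law_block μ k (measurable_neg_log_measureReal hG)
      (integrable_of_finset hG _)
    rw [integral_neg_log_eq_shannonEntropy hG] at hlaw
    filter_upwards [hlaw, ae_block_mem μ hG, hsp.ae_exists_tendsto hF hpos]
      with ω hω hmem ⟨l, hl, hrate⟩
    rw [hl.limUnder_eq]
    have hinfo : ∀ᶠ n : ℕ in atTop, Real.exp (-(n * a)) ≤ ∏ j : Fin n, q (block k j ω) := by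
      filter_upwards [hω.eventually_le_const ha, eventually_gt_atTop 0] with n hn hn0
      rw [div_le_iff₀ (Nat.cast_pos.2 hn0), Finset.sum_neg_distrib] at hn
      rw [Fin.prod_univ_eq_prod_range (fun j => q (block k j ω)) n]
      have hexp : ∏ j ∈ Finset.range n, q (block k j ω)
          = Real.exp (∑ j ∈ Finset.range n, Real.log (q (block k j ω))) := by
        rw [Real.exp_sum]
        exact Finset.prod_congr rfl fun j _ =>
          (Real.exp_log (Finset.mem_filter.1 (hmem j)).2).symm
      rw [hexp, Real.exp_le_exp]
      linarith
    have hdist := (tendsto_id.atTop_mul_const' (Nat.pos_of_ne_zero hk)).eventually (hrate b hb)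
    obtain ⟨N, hN⟩ := eventually_atTop.1 (hinfo.and hdist)
    refine Set.mem_iUnion.2 ⟨N, Set.mem_iInter₂.2 fun n hn => ?_⟩
    obtain ⟨h1, h2⟩ := hN n hn
    have hw : (fun j : Fin n => block k j ω) ∈ W n :=
      Finset.mem_filter.2 ⟨Fintype.mem_piFinset.2 fun j => hmem j, h1⟩
    have hc : c n (fun j : Fin n => block k j ω) = p (walk ω (n * k)) := by
      rw [← walk_block]
      exact congrArg p (walk_congr fun i hi => by simp [hi])
    refine Set.mem_iUnion.2 ⟨⟨_, Finset.mem_image_of_mem _ hw⟩, ?_⟩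
    rw [Metric.mem_closedBall, dist_comm, Real.dist_eq]
    change |c n (fun j : Fin n => block k j ω) - l| ≤ _
    rw [hc]
    refine h2.trans_eq ?_
    simp only [id, Nat.cast_mul]
    ring_nf
  · rw [dimH_iUnion]
    refine iSup_le fun N => dimH_le_of_exp_covers (shannonEntropy_nonneg.trans ha.le)
      (mul_pos hk0 hb0) T (Eventually.of_forall fun n => ?_) ?_
    · exact (Nat.cast_le.2 Finset.card_image_le).trans
        (card_filter_prod_le G (fun g => measureReal_nonneg) hsum n (n * a))
    · filter_upwards [eventually_ge_atTop N] with n hn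
      exact Set.iInter₂_subset n hn

/-- The dimension of the limit law is at most the ratio of the asymptotic entropy to the rate of
contraction. -/
theorem measureDim_le (hsp : IsAffineAction s p) (hF : μ (F : Set Sol)ᶜ = 0)
    (hpos : 0 < ∫ g, s g ∂μ) :
    measureDim ((incrementLaw μ).map fun ω => limUnder atTop fun n => p (walk ω n))
      ≤ ENNReal.ofReal (asymptoticEntropy μ / ∫ g, s g ∂μ) := by
  set α := ∫ g, s g ∂μ
  refine ge_of_tendsto (ENNReal.tendsto_ofReal
    ((tendsto_shannonEntropy_convPow_div hF).div_const α)) ?_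
  filter_upwards [eventually_ne_atTop 0] with k hk
  have hk0 : (k : ℝ) ≠ 0 := Nat.cast_ne_zero.2 hk
  have hlim : Tendsto (fun d : ℝ => (shannonEntropy (convPow μ k) + d) / (k * (α - d)))
      (𝓝[>] 0) (𝓝 (shannonEntropy (convPow μ k) / k / α)) := by
    have hcont : ContinuousAt
        (fun d : ℝ => (shannonEntropy (convPow μ k) + d) / (k * (α - d))) 0 :=
      ContinuousAt.div (by fun_prop) (by fun_prop) (by simp [hk0, hpos.ne'])
    have := hcont.tendsto.mono_left (nhdsWithin_le_nhds (s := Set.Ioi 0))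
    simpa [div_div] using this
  refine ge_of_tendsto (ENNReal.tendsto_ofReal hlim) ?_
  filter_upwards [Ioo_mem_nhdsGT hpos] with d hd
  exact hsp.measureDim_le_of_block hF hk (by linarith [hd.1]) (by linarith [hd.2])
    (by linarith [hd.1])

end IsAffineAction

end Sol

theorem mainTheorem2 (μ : Measure Sol) [IsProbabilityMeasure μ]
    (hfin : ∃ F : Set Sol, F.Finite ∧ μ Fᶜ = 0) (hdrift : Sol.drift μ ≠ 0) :
    (0 < Sol.drift μ → ∀ᵐ ω ∂(Sol.incrementLaw μ),
      Tendsto (fun n => (Sol.walk ω n).x) atTop (𝓝 (Sol.xi ω))) ∧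
    (Sol.drift μ < 0 → ∀ᵐ ω ∂(Sol.incrementLaw μ),
      Tendsto (fun n => (Sol.walk ω n).y) atTop (𝓝 (Sol.xi' ω))) ∧
    IsProbabilityMeasure (Sol.harmonicMeasure μ) ∧
    Tendsto (fun k : ℕ => Sol.shannonEntropy (Sol.convPow μ k) / k) atTop
      (𝓝 (Sol.asymptoticEntropy μ)) ∧
    measureDim (Sol.harmonicMeasure μ) ≤
      ENNReal.ofReal (Sol.asymptoticEntropy μ / |Sol.drift μ|) := by
  obtain ⟨F', hfinite, hF'⟩ := hfin
  obtain ⟨F, rfl⟩ := hfinite.exists_finset_coe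
  have hneg : ∫ g, -Sol.z g ∂μ = -Sol.drift μ := integral_neg _
  refine ⟨fun h => Sol.isAffineAction_z_x.ae_tendsto_limUnder hF' h,
    fun h => Sol.isAffineAction_neg_z_y.ae_tendsto_limUnder hF' (by rw [hneg]; linarith), ?_,
    Sol.tendsto_shannonEntropy_convPow_div hF', ?_⟩
  · rcases hdrift.lt_or_gt with h | h
    · rw [Sol.harmonicMeasure, if_neg h.not_gt]
      exact Measure.isProbabilityMeasure_map
        (Sol.isAffineAction_neg_z_y.aemeasurable_limUnder hF' (by rw [hneg]; linarith))
    · rw [Sol.harmonicMeasure, if_pos h]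
      exact Measure.isProbabilityMeasure_map (Sol.isAffineAction_z_x.aemeasurable_limUnder hF' h)
  · rcases hdrift.lt_or_gt with h | h
    · rw [Sol.harmonicMeasure, if_neg h.not_gt, abs_of_neg h, ← hneg]
      exact Sol.isAffineAction_neg_z_y.measureDim_le hF' (by rw [hneg]; linarith)
    · rw [Sol.harmonicMeasure, if_pos h, abs_of_pos h]
      exact Sol.isAffineAction_z_x.measureDim_le hF' h
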